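/- Let $V$ be an $n$-dimensional Riemannian orbifold on a second countable Hausdorff space $|V|$, given by connected open sets $U_i\subset\mathbb{R}^n$ with smooth Riemannian metrics $h_i$, finite groups $\Gamma_i$ of isometries of $(U_i,h_i)$, continuous open maps $q_i:U_i\to|V|$ which induce homeomorphisms of $U_i/\Gamma_i$ onto open sets $V_i$ that cover $|V|$, and such that, whenever $q_i(x_i)=q_j(x_j)$, there is a change of charts $\varphi_{ji}$, i.e. an isometry from a connected open neighbourhood of $x_i$ in $U_i$ onto a connected open neighbourhood of $x_j$ in $U_j$ with $q_j\varphi_{ji}=q_i$ on its domain. A function $f:|V|\to\mathbb{R}$ is smooth, $f\in C^\infty(V)$, if it is continuous and around every point there is a chart $(U_i,\Gamma_i,q_i)$ with $f q_i\in C^\infty(U_i)$. Let $\pi_i:\tilde U_i\to U_i$ be the bundle of orthonormal frames of $(U_i,h_i)$. The foliated resolution $\tilde V$ of $V$ is the manifold obtained by gluing the quotients $\tilde V_i=\tilde U_i/\Gamma_i$ along the lifts $(x,u)\mapsto(\varphi_{ji}(x),\varphi_{ji*}u)$ of the changes of charts. Its charts are $[u]\mapsto(M_u,\pi_i u)\in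 O(n)\times U_i$, where $M_u$ is the orthogonal matrix of the frame $u$ with respect to a local smooth orthonormal frame field. The projection $p:\tilde V\to V$ is $p[u]=q_i\pi_i u$ for $u\in\tilde U_i$. The leaves of $\mathcal F$ are the orbits of the right action $[u]M=[uM]$ of $O(n)$ on $\tilde V$ (they are the fibres of $p$). A foliated function, $g\in C^\infty(\tilde V,\mathcal F)$, is a smooth function on $\tilde V$ that is constant along each leaf. Then $f\mapsto f\circ p$ maps $C^\infty(V)$ into $C^\infty(\tilde V,\mathcal F)$, and $$p^*:C^\infty(V)\to C^\infty(\tilde V,\mathcal F),\qquad p^*f=f\circ p,$$ is an isomorphism of real vector spaces. -/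

import Mathlib

open scoped ContDiff Topology

/-- `h` is a smooth Riemannian metric on the open set `U` of `ℝⁿ` (only values on `U` matter). -/
structure IsRiemannianMetricOn {n : ℕ} (U : Set (EuclideanSpace ℝ (Fin n)))
    (h : EuclideanSpace ℝ (Fin n) →
      EuclideanSpace ℝ (Fin n) →L[ℝ] EuclideanSpace ℝ (Fin n) →L[ℝ] ℝ) : Prop where
  contDiffOn : ContDiffOn ℝ ∞ h U
  symm : ∀ x ∈ U, ∀ v w, h x v w = h x w v
  pos : ∀ x ∈ U, ∀ v, v ≠ 0 → 0 < h x v v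

/-- `φ` is an isometry (a diffeomorphism that preserves the metric tensors) from the Riemannian
manifold `(φ.source, h)` onto the Riemannian manifold `(φ.target, h')`. -/
structure IsRiemannianIsometry {n : ℕ}
    (h h' : EuclideanSpace ℝ (Fin n) →
      EuclideanSpace ℝ (Fin n) →L[ℝ] EuclideanSpace ℝ (Fin n) →L[ℝ] ℝ)
    (φ : OpenPartialHomeomorph (EuclideanSpace ℝ (Fin n)) (EuclideanSpace ℝ (Fin n))) : Prop where
  contDiffOn : ContDiffOn ℝ ∞ φ φ.source
  contDiffOn_symm : ContDiffOn ℝ ∞ φ.symm φ.target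
  preserves : ∀ x ∈ φ.source, ∀ v w,
    h' (φ x) (fderiv ℝ φ x v) (fderiv ℝ φ x w) = h x v w

/-- `φ` is a change of charts between the uniformizations `(U, h, q)` and `(U', h', q')`: an
isometry from an open connected subset of `U` onto an open (connected) subset of `U'` such that
`q' ∘ φ = q`. -/
structure IsChangeOfCharts {n : ℕ} {X : Type*} (U U' : Set (EuclideanSpace ℝ (Fin n)))
    (h h' : EuclideanSpace ℝ (Fin n) →
      EuclideanSpace ℝ (Fin n) →L[ℝ] EuclideanSpace ℝ (Fin n) →L[ℝ] ℝ)
    (q q' : EuclideanSpace ℝ (Fin n) → X)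
    (φ : OpenPartialHomeomorph (EuclideanSpace ℝ (Fin n)) (EuclideanSpace ℝ (Fin n))) : Prop where
  source_subset : φ.source ⊆ U
  target_subset : φ.target ⊆ U'
  connected : IsConnected φ.source
  isometry : IsRiemannianIsometry h h' φ
  comp_eq : ∀ x ∈ φ.source, q' (φ x) = q x

/-- An `n`-dimensional Riemannian orbifold structure on the space `X`, with atlas indexed by `ι`.
The open cover consists of the sets `V_i = q_i(U_i)`. The local uniformization `q i` matters on
`U i` only. -/
structure RiemannianOrbifold (n : ℕ) (X : Type*) [TopologicalSpace X] (ι : Type*) where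
  /-- the chart domains in `ℝⁿ` -/
  U : ι → Set (EuclideanSpace ℝ (Fin n))
  isOpen_U : ∀ i, IsOpen (U i)
  isConnected_U : ∀ i, IsConnected (U i)
  /-- the Riemannian metrics -/
  h : ι → EuclideanSpace ℝ (Fin n) →
    EuclideanSpace ℝ (Fin n) →L[ℝ] EuclideanSpace ℝ (Fin n) →L[ℝ] ℝ
  isRiemannianMetricOn : ∀ i, IsRiemannianMetricOn (U i) (h i)
  /-- the finite groups of isometries -/
  Γ : (i : ι) → Subgroup (Equiv.Perm (U i))
  finite_Γ : ∀ i, Finite (Γ i)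
  isometry_Γ : ∀ i, ∀ g ∈ Γ i,
    ∃ φ : OpenPartialHomeomorph (EuclideanSpace ℝ (Fin n)) (EuclideanSpace ℝ (Fin n)),
      φ.source = U i ∧ φ.target = U i ∧ IsRiemannianIsometry (h i) (h i) φ ∧
        ∀ x : U i, φ x = g x
  /-- the local uniformizations -/
  q : ι → EuclideanSpace ℝ (Fin n) → X
  /-- `q i` is continuous and open on `U i`, and its fibres are the `Γ i`-orbits; that is, it is
  open and induces a homeomorphism from `U i / Γ i` onto the open set `q i (U i)`. -/
  continuousOn_q : ∀ i, ContinuousOn (q i) (U i)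
  isOpen_image_q : ∀ i, ∀ O ⊆ U i, IsOpen O → IsOpen (q i '' O)
  q_eq_iff : ∀ i, ∀ x y : U i, q i x = q i y ↔ ∃ g ∈ Γ i, g x = y
  cover : ∀ v : X, ∃ i, v ∈ q i '' U i
  exists_change : ∀ i j, ∀ x ∈ U i, ∀ y ∈ U j, q i x = q j y →
    ∃ φ : OpenPartialHomeomorph (EuclideanSpace ℝ (Fin n)) (EuclideanSpace ℝ (Fin n)),
      x ∈ φ.source ∧ y ∈ φ.target ∧ IsChangeOfCharts (U i) (U j) (h i) (h j) (q i) (q j) φ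

namespace RiemannianOrbifold

/-! ### Smooth functions on an orbifold -/

/-- A function on the orbifold is smooth if it is continuous and, around every point, there is a
chart in which it is smooth. -/
def IsSmooth {n : ℕ} {X ι : Type*} [TopologicalSpace X] (V : RiemannianOrbifold n X ι)
    (f : X → ℝ) : Prop :=
  Continuous f ∧ ∀ v : X, ∃ i, v ∈ V.q i '' V.U i ∧ ContDiffOn ℝ ∞ (fun x => f (V.q i x)) (V.U i)

/-- A smooth function is smooth in every chart. -/
theorem IsSmooth.contDiffOn {n : ℕ} {X ι : Type*} [TopologicalSpace X]
    {V : RiemannianOrbifold n X ι} {f : X → ℝ} (hf : V.IsSmooth f) (j : ι) :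
    ContDiffOn ℝ ∞ (fun x => f (V.q j x)) (V.U j) := by
  intro y hy
  obtain ⟨i, ⟨x, hx, hxy⟩, hi⟩ := hf.2 (V.q j y)
  obtain ⟨φ, hyφ, -, hφ⟩ := V.exists_change j i y hy x hx hxy.symm
  have h1 : ContDiffOn ℝ ∞ (fun z => f (V.q i (φ z))) φ.source :=
    hi.comp hφ.isometry.contDiffOn
      (fun z hz => hφ.target_subset (φ.map_source hz))
  have h2 : ContDiffOn ℝ ∞ (fun z => f (V.q j z)) φ.source :=
    h1.congr fun z hz => by rw [hφ.comp_eq z hz]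
  exact (h2.contDiffAt (φ.open_source.mem_nhds hyφ)).contDiffWithinAt

/-- The space `C^∞(V)` of smooth functions on the orbifold. -/
def smoothFunctions {n : ℕ} {X ι : Type*} [TopologicalSpace X] (V : RiemannianOrbifold n X ι) :
    Submodule ℝ (X → ℝ) where
  carrier := {f | V.IsSmooth f}
  zero_mem' := ⟨continuous_const, fun v =>
    let ⟨i, hi⟩ := V.cover v
    ⟨i, hi, contDiffOn_const⟩⟩
  add_mem' := fun hf hg => ⟨hf.1.add hg.1, fun v =>
    let ⟨i, hi⟩ := V.cover v
    ⟨i, hi, (hf.contDiffOn i).add (hg.contDiffOn i)⟩⟩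
  smul_mem' := fun c _ hf => ⟨hf.1.const_smul c, fun v =>
    let ⟨i, hi⟩ := V.cover v
    ⟨i, hi, contDiffOn_const.smul (hf.contDiffOn i)⟩⟩

/-! ### The foliated resolution -/

/-- The vectors `u 0, …, u (n-1)` are orthonormal for the metric of the chart `i` at `x`. -/
def IsOrthonormalAt {n : ℕ} {X ι : Type*} [TopologicalSpace X] (V : RiemannianOrbifold n X ι)
    (i : ι) (x : EuclideanSpace ℝ (Fin n)) (u : Fin n → EuclideanSpace ℝ (Fin n)) : Prop :=
  ∀ a b, V.h i x (u a) (u b) = if a = b then 1 else 0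

/-- The bundle of orthonormal frames of the Riemannian manifold `(U i, h i)`. -/
structure Frame {n : ℕ} {X ι : Type*} [TopologicalSpace X] (V : RiemannianOrbifold n X ι)
    (i : ι) where
  /-- the base point -/
  pt : EuclideanSpace ℝ (Fin n)
  pt_mem : pt ∈ V.U i
  /-- the vectors of the frame -/
  vec : Fin n → EuclideanSpace ℝ (Fin n)
  orthonormal : V.IsOrthonormalAt i pt vec

/-- `(u M)_b = ∑ a, u_a M_{ab}`. -/
def rotate {n : ℕ} (u : Fin n → EuclideanSpace ℝ (Fin n)) (M : Matrix (Fin n) (Fin n) ℝ) :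
    Fin n → EuclideanSpace ℝ (Fin n) :=
  fun b => ∑ a, M a b • u a

theorem IsOrthonormalAt.rotate {n : ℕ} {X ι : Type*} [TopologicalSpace X]
    {V : RiemannianOrbifold n X ι} {i : ι} {x : EuclideanSpace ℝ (Fin n)}
    {u : Fin n → EuclideanSpace ℝ (Fin n)} (hu : V.IsOrthonormalAt i x u)
    (M : Matrix.orthogonalGroup (Fin n) ℝ) :
    V.IsOrthonormalAt i x (RiemannianOrbifold.rotate u M.1) := by
  intro b d
  have hM : M.1.transpose * M.1 = 1 := (Matrix.mem_orthogonalGroup_iff' (Fin n) ℝ).1 M.2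
  have h1 := congrFun (congrFun hM b) d
  rw [Matrix.one_apply, Matrix.mul_apply] at h1
  rw [← h1]
  simp only [RiemannianOrbifold.rotate, map_sum, map_smul, sum_apply,
    smul_apply, hu _ _, smul_eq_mul, Matrix.transpose_apply]
  simp [mul_comm]

/-- The right action of `O(n)` on orthonormal frames. -/
def Frame.act {n : ℕ} {X ι : Type*} [TopologicalSpace X] {V : RiemannianOrbifold n X ι} {i : ι}
    (u : V.Frame i) (M : Matrix.orthogonalGroup (Fin n) ℝ) : V.Frame i :=
  ⟨u.pt, u.pt_mem, rotate u.vec M.1, u.orthonormal.rotate M⟩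

/-- Two orthonormal frames, in charts `i` and `j`, are identified if the lift
`(x, u) ↦ (φ x, φ_* u)` of a change of charts `φ` maps the first to the second. For `i = j` this
comprises the lifted action of `Γ i`, because the elements of `Γ i` are changes of charts. -/
def FrameRel {n : ℕ} {X ι : Type*} [TopologicalSpace X] (V : RiemannianOrbifold n X ι)
    (u v : Σ i, V.Frame i) : Prop :=
  ∃ φ : OpenPartialHomeomorph (EuclideanSpace ℝ (Fin n)) (EuclideanSpace ℝ (Fin n)),
    IsChangeOfCharts (V.U u.1) (V.U v.1) (V.h u.1) (V.h v.1) (V.q u.1) (V.q v.1) φ ∧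
      u.2.pt ∈ φ.source ∧ φ u.2.pt = v.2.pt ∧ ∀ a, fderiv ℝ φ u.2.pt (u.2.vec a) = v.2.vec a

/-- The foliated resolution of the orbifold, as a set: the frame bundles of the charts, divided by
the groups `Γ i` and glued along the lifts of the changes of charts. -/
def Resolution {n : ℕ} {X ι : Type*} [TopologicalSpace X] (V : RiemannianOrbifold n X ι) : Type _ :=
  Quot V.FrameRel

/-- The class of a frame in the resolution. -/
def Resolution.mk {n : ℕ} {X ι : Type*} [TopologicalSpace X] {V : RiemannianOrbifold n X ι}
    {i : ι} (u : V.Frame i) : V.Resolution :=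
  Quot.mk _ ⟨i, u⟩

/-- The projection `p` of the resolution onto the orbifold, `p [u] = q_i (π_i u)`. -/
def proj {n : ℕ} {X ι : Type*} [TopologicalSpace X] (V : RiemannianOrbifold n X ι) :
    V.Resolution → X :=
  Quot.lift (fun u => V.q u.1 u.2.pt) (by
    rintro ⟨i, u⟩ ⟨j, v⟩ ⟨φ, hφ, hu, huv, -⟩
    have := hφ.comp_eq _ hu
    rw [huv] at this
    exact this.symm)

/-- The right action of `O(n)` on the resolution, `[u] M = [u M]`. -/
def Resolution.act {n : ℕ} {X ι : Type*} [TopologicalSpace X] {V : RiemannianOrbifold n X ι}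
    (v : V.Resolution) (M : Matrix.orthogonalGroup (Fin n) ℝ) : V.Resolution :=
  Quot.map (fun u : Σ i, V.Frame i => (⟨u.1, u.2.act M⟩ : Σ i, V.Frame i)) (by
    rintro ⟨i, u⟩ ⟨j, v⟩ ⟨φ, hφ, hu, huv, hd⟩
    refine ⟨φ, hφ, hu, huv, fun a => ?_⟩
    simp only [Frame.act, rotate, map_sum, map_smul]
    exact Finset.sum_congr rfl fun b _ => by rw [← hd b]) v

/-- The leaf of the foliation through `v`: the orbit of `v` under `O(n)`. -/
def leaf {n : ℕ} {X ι : Type*} [TopologicalSpace X] (V : RiemannianOrbifold n X ι)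
    (v : V.Resolution) : Set V.Resolution :=
  Set.range fun M : Matrix.orthogonalGroup (Fin n) ℝ => v.act M

/-- A local trivialization of the orthonormal frame bundle of `(U i, h i)`, given by a smooth
orthonormal frame field on an open subset of `U i`. -/
structure Trivialization {n : ℕ} {X ι : Type*} [TopologicalSpace X] (V : RiemannianOrbifold n X ι)
    (i : ι) where
  /-- the domain -/
  dom : Set (EuclideanSpace ℝ (Fin n))
  isOpen_dom : IsOpen dom
  dom_subset : dom ⊆ V.U i
  /-- the frame field -/
  field : EuclideanSpace ℝ (Fin n) → Fin n → EuclideanSpace ℝ (Fin n)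
  contDiffOn_field : ContDiffOn ℝ ∞ field dom
  orthonormal : ∀ x ∈ dom, V.IsOrthonormalAt i x (field x)

/-- The (inverse of the) coordinate systems of the resolution: the trivialization `s` gives the
map `(x, M) ↦ [s(x) M]` from `dom × O(n)`. Its restrictions to small open sets, on which it is
injective, are the inverses of the charts `[u] ↦ (M_u, π_i u)` of the atlas of the resolution.
These charts are adapted to the foliation, `x` being the transverse coordinates. -/
def Trivialization.param {n : ℕ} {X ι : Type*} [TopologicalSpace X] {V : RiemannianOrbifold n X ι}
    {i : ι} (s : V.Trivialization i) (x : s.dom) (M : Matrix.orthogonalGroup (Fin n) ℝ) :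
    V.Resolution :=
  Resolution.mk ⟨x.1, s.dom_subset x.2, rotate (s.field x.1) M.1, (s.orthonormal x.1 x.2).rotate M⟩

/-- A function on the resolution is smooth if it is so in all the coordinate systems. Smoothness
on `dom × O(n)` refers to the submanifold `O(n)` of the space of matrices: near every point, the
function is the restriction of a smooth function of `(x, M) ∈ ℝⁿ × ℝⁿˣⁿ`. -/
def IsSmoothOnResolution {n : ℕ} {X ι : Type*} [TopologicalSpace X] (V : RiemannianOrbifold n X ι)
    (g : V.Resolution → ℝ) : Prop :=
  ∀ (i : ι) (s : V.Trivialization i) (x : s.dom) (M : Matrix.orthogonalGroup (Fin n) ℝ),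
    ∃ (N : Set (EuclideanSpace ℝ (Fin n) × (Fin n → Fin n → ℝ)))
      (F : EuclideanSpace ℝ (Fin n) × (Fin n → Fin n → ℝ) → ℝ),
      IsOpen N ∧ (x.1, fun a b => M.1 a b) ∈ N ∧ ContDiffOn ℝ ∞ F N ∧
        ∀ (y : s.dom) (P : Matrix.orthogonalGroup (Fin n) ℝ),
          (y.1, fun a b => P.1 a b) ∈ N → F (y.1, fun a b => P.1 a b) = g (s.param y P)

/-- A function on the resolution is foliated if it is smooth and constant along the leaves. -/
def IsFoliated {n : ℕ} {X ι : Type*} [TopologicalSpace X] (V : RiemannianOrbifold n X ι)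
    (g : V.Resolution → ℝ) : Prop :=
  V.IsSmoothOnResolution g ∧ ∀ v : V.Resolution, ∀ w ∈ V.leaf v, g w = g v

/-- The space of foliated functions on the resolution. -/
def foliatedFunctions {n : ℕ} {X ι : Type*} [TopologicalSpace X] (V : RiemannianOrbifold n X ι) :
    Submodule ℝ (V.Resolution → ℝ) where
  carrier := {g | V.IsFoliated g}
  zero_mem' := ⟨fun _ _ _ _ => ⟨Set.univ, fun _ => 0, isOpen_univ, trivial, contDiffOn_const,
    fun _ _ _ => rfl⟩, fun _ _ _ => rfl⟩
  add_mem' := by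
    rintro f g ⟨hf, hf'⟩ ⟨hg, hg'⟩
    refine ⟨fun i s x M => ?_, fun v w hw => ?_⟩
    · obtain ⟨N, F, hN, hx, hF, h⟩ := hf i s x M
      obtain ⟨N', F', hN', hx', hF', h'⟩ := hg i s x M
      refine ⟨N ∩ N', fun z => F z + F' z, hN.inter hN', ⟨hx, hx'⟩,
        (hF.mono Set.inter_subset_left).add (hF'.mono Set.inter_subset_right),
        fun y P hy => ?_⟩
      exact congrArg₂ (· + ·) (h y P hy.1) (h' y P hy.2)
    · rw [Pi.add_apply, Pi.add_apply, hf' v w hw, hg' v w hw]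
  smul_mem' := by
    rintro c g ⟨hg, hg'⟩
    refine ⟨fun i s x M => ?_, fun v w hw => ?_⟩
    · obtain ⟨N, F, hN, hx, hF, h⟩ := hg i s x M
      refine ⟨N, fun z => c • F z, hN, hx, hF.const_smul c, fun y P hy => ?_⟩
      exact congrArg (c • ·) (h y P hy)
    · rw [Pi.smul_apply, Pi.smul_apply, hg' v w hw]

end RiemannianOrbifold

/-! ### Orthonormal frames of a Riemannian metric -/

namespace IsRiemannianMetricOn

/-! The point is that the leaves are exactly the fibres of `p` (`mem_leaf_iff`) and that `p` has
smooth local sections over the charts. Two frames over the same point of the orbifold can be moved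
to a common base point by a change of charts followed by an element of the local group, neither of
which alters their classes; there `O(n)` acts transitively on orthonormal frames. As `p` is onto, a
function constant on the leaves is therefore `f ∘ p` for a unique `f`.

Smoothness is local. In the coordinates `(x, M)` of a frame field, `f ∘ p` is `f ∘ q_i` with no
dependence on `M`; conversely, setting `M = 1` recovers `f ∘ q_i` from `f ∘ p`. The converse needs a
smooth orthonormal frame field near each point, which Gram–Schmidt supplies. -/

/-- Around every point there are `k ≤ n` smooth orthonormal vector fields. -/
theorem exists_orthonormal_fields {n : ℕ} {U : Set (EuclideanSpace ℝ (Fin n))}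
    {h : EuclideanSpace ℝ (Fin n) →
      EuclideanSpace ℝ (Fin n) →L[ℝ] EuclideanSpace ℝ (Fin n) →L[ℝ] ℝ}
    (hh : IsRiemannianMetricOn U h) (hU : IsOpen U) {x : EuclideanSpace ℝ (Fin n)} (hx : x ∈ U)
    (k : ℕ) (hk : k ≤ n) :
    ∃ (D : Set (EuclideanSpace ℝ (Fin n)))
      (u : Fin k → EuclideanSpace ℝ (Fin n) → EuclideanSpace ℝ (Fin n)),
      IsOpen D ∧ x ∈ D ∧ D ⊆ U ∧ (∀ a, ContDiffOn ℝ ∞ (u a) D) ∧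
        ∀ y ∈ D, ∀ a b, h y (u a y) (u b y) = if a = b then 1 else 0 := by
  induction k with
  | zero => exact ⟨U, fun a => a.elim0, hU, hx, subset_rfl, fun a => a.elim0,
      fun _ _ a => a.elim0⟩
  | succ k ih =>
    obtain ⟨D, u, hD, hxD, hDU, hu, ho⟩ := ih (by omega)
    -- Fewer than `n` vectors cannot span `ℝⁿ`.
    obtain ⟨w, hw⟩ : ∃ w, w ∉ Submodule.span ℝ (Set.range fun a => u a x) := by
      by_contra! hc
      have h1 := finrank_range_le_card (R := ℝ) fun a => u a x
      rw [Set.finrank, (Submodule.eq_top_iff' (p := Submodule.span ℝ _)).2 hc, finrank_top,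
        finrank_euclideanSpace_fin, Fintype.card_fin] at h1
      omega
    have hhD := hh.contDiffOn.mono hDU
    -- the component of `w` orthogonal to the fields `u a`
    let w' : EuclideanSpace ℝ (Fin n) → EuclideanSpace ℝ (Fin n) :=
      fun y => w - ∑ a, h y (u a y) w • u a y
    have hw' : ContDiffOn ℝ ∞ w' D := contDiffOn_const.sub <| ContDiffOn.sum fun a _ =>
      ((hhD.clm_apply (hu a)).clm_apply contDiffOn_const).smul (hu a)
    have hne : w' x ≠ 0 := fun h0 => hw <| by
      rw [sub_eq_zero.1 h0]
      exact Submodule.sum_mem _ fun a _ =>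
        Submodule.smul_mem _ _ (Submodule.subset_span ⟨a, rfl⟩)
    have horth : ∀ y ∈ D, ∀ b, h y (u b y) (w' y) = 0 := fun y hy b => by
      simp [w', ho y hy]
    have hpos : ∀ y ∈ D ∩ w' ⁻¹' {0}ᶜ, 0 < h y (w' y) (w' y) := fun y hy =>
      hh.pos y (hDU hy.1) _ hy.2
    have hN : ContDiffOn ℝ ∞ (fun y => (Real.sqrt (h y (w' y) (w' y)))⁻¹ • w' y)
        (D ∩ w' ⁻¹' {0}ᶜ) := by
      have hw'' := hw'.mono (Set.inter_subset_left (t := w' ⁻¹' {0}ᶜ))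
      have h2 := ((hhD.mono Set.inter_subset_left).clm_apply hw'').clm_apply hw''
      exact ((h2.sqrt fun y hy => (hpos y hy).ne').inv fun y hy =>
        (Real.sqrt_pos.2 (hpos y hy)).ne').smul hw''
    -- The domain shrinks to where `w'` is nonzero, so that its length is positive and normalizing
    -- it is smooth.
    refine ⟨D ∩ w' ⁻¹' {0}ᶜ,
      Fin.snoc (α := fun _ => EuclideanSpace ℝ (Fin n) → EuclideanSpace ℝ (Fin n)) u
        fun y => (Real.sqrt (h y (w' y) (w' y)))⁻¹ • w' y,
      hw'.continuousOn.isOpen_inter_preimage hD isOpen_compl_singleton, ⟨hxD, hne⟩,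
      Set.inter_subset_left.trans hDU, fun a => ?_, fun y hy a b => ?_⟩
    · refine Fin.lastCases ?_ (fun a => ?_) a
      · simpa only [Fin.snoc_last] using hN
      · simpa only [Fin.snoc_castSucc] using (hu a).mono Set.inter_subset_left
    · have h3 : ∀ b, h y (w' y) (u b y) = 0 := fun b => by
        rw [hh.symm y (hDU hy.1), horth y hy.1]
      refine Fin.lastCases ?_ (fun a => ?_) a <;> refine Fin.lastCases ?_ (fun b => ?_) b
      · have h4 := Real.sqrt_pos.2 (hpos y hy)
        simp only [Fin.snoc_last, map_smul, smul_apply, smul_eq_mul, if_true]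
        -- The third occurrence is the one outside the square roots.
        nth_rewrite 3 [← Real.mul_self_sqrt (hpos y hy).le]
        field_simp
      · simp [h3, (Fin.castSucc_lt_last b).ne']
      · simp [horth y hy.1, (Fin.castSucc_lt_last a).ne]
      · simp [ho y hy.1]

end IsRiemannianMetricOn

/-! ### Frames over a chart, leaves as fibres, and descent of functions -/

namespace RiemannianOrbifold

variable {n : ℕ} {X ι : Type*} [TopologicalSpace X] {V : RiemannianOrbifold n X ι}

/-- Every point of a chart lies in the domain of a local trivialization of the frame bundle. -/
theorem exists_trivialization (V : RiemannianOrbifold n X ι) {i : ι}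
    {x : EuclideanSpace ℝ (Fin n)} (hx : x ∈ V.U i) : ∃ s : V.Trivialization i, x ∈ s.dom := by
  obtain ⟨D, u, hD, hxD, hDU, hu, ho⟩ :=
    (V.isRiemannianMetricOn i).exists_orthonormal_fields (V.isOpen_U i) hx n le_rfl
  exact ⟨⟨D, hD, hDU, fun y a => u a y, contDiffOn_pi.2 hu, ho⟩, hxD⟩

theorem exists_frame (V : RiemannianOrbifold n X ι) {i : ι}
    {x : EuclideanSpace ℝ (Fin n)} (hx : x ∈ V.U i) : ∃ u : V.Frame i, u.pt = x := by
  obtain ⟨s, hs⟩ := V.exists_trivialization hx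
  exact ⟨⟨x, hx, s.field x, s.orthonormal x hs⟩, rfl⟩

/-- Pairing with the frame reads off coefficients, so the `n` vectors are independent and hence span
`ℝⁿ`. This is the expansion behind transitivity of `O(n)`. -/
theorem IsOrthonormalAt.sum_smul {i : ι} {x : EuclideanSpace ℝ (Fin n)}
    {u : Fin n → EuclideanSpace ℝ (Fin n)} (hu : V.IsOrthonormalAt i x u)
    (w : EuclideanSpace ℝ (Fin n)) : ∑ a, V.h i x (u a) w • u a = w := by
  have hc : ∀ (c : Fin n → ℝ) (b : Fin n), V.h i x (u b) (∑ a, c a • u a) = c b := fun c b => by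
    simp [hu b _]
  have hli : LinearIndependent ℝ u := Fintype.linearIndependent_iff.2 fun c h0 b => by
    rw [← hc c b, h0, map_zero]
  have hw : w ∈ Submodule.span ℝ (Set.range u) := by
    rw [hli.span_eq_top_of_card_eq_finrank' (by simp)]
    trivial
  obtain ⟨c, rfl⟩ := (Submodule.mem_span_range_iff_exists_fun ℝ).1 hw
  simp only [hc]

/-- `O(n)` acts transitively on the orthonormal frames at a point. -/
theorem Frame.exists_act_eq {i : ι} {u v : V.Frame i} (huv : u.pt = v.pt) :
    ∃ M, u.act M = v := by
  obtain ⟨x, hx, u, hu⟩ := u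
  obtain ⟨y, hy, v, hv⟩ := v
  obtain rfl : x = y := huv
  -- Column `b` holds the coordinates of `v b` in the frame `u`; expanding `h (v b) (v d)` in them
  -- gives `Mᵀ M = 1`.
  refine ⟨⟨Matrix.of fun a b => V.h i x (u a) (v b),
    (Matrix.mem_orthogonalGroup_iff' _ _).2 ?_⟩, ?_⟩
  · ext b d
    rw [Matrix.mul_apply, Matrix.one_apply, ← hv b d]
    conv_rhs => rw [← hu.sum_smul (v b)]
    simp only [map_sum, map_smul, sum_apply, smul_apply, smul_eq_mul, Matrix.transpose_apply,
      Matrix.of_apply]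
  · have : RiemannianOrbifold.rotate u (Matrix.of fun a b => V.h i x (u a) (v b)) = v :=
      funext fun b => hu.sum_smul (v b)
    simp only [Frame.act, this]

/-- A change of charts carries orthonormal frames to equivalent orthonormal frames. -/
theorem Frame.exists_mk_eq {i j : ι}
    {φ : OpenPartialHomeomorph (EuclideanSpace ℝ (Fin n)) (EuclideanSpace ℝ (Fin n))}
    (hφ : IsChangeOfCharts (V.U i) (V.U j) (V.h i) (V.h j) (V.q i) (V.q j) φ) (u : V.Frame i)
    (hu : u.pt ∈ φ.source) : ∃ v : V.Frame j, v.pt = φ u.pt ∧ Resolution.mk u = Resolution.mk v :=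
  ⟨⟨φ u.pt, hφ.target_subset (φ.map_source hu), fun a => fderiv ℝ φ u.pt (u.vec a), fun a b => by
    rw [hφ.isometry.preserves _ hu, u.orthonormal]⟩, rfl,
    Quot.sound ⟨φ, hφ, hu, rfl, fun _ => rfl⟩⟩

/-- The elements of `Γ i` extend to changes of charts. -/
theorem exists_change_of_mem_Γ (V : RiemannianOrbifold n X ι) {i : ι}
    {g : Equiv.Perm (V.U i)} (hg : g ∈ V.Γ i) :
    ∃ φ : OpenPartialHomeomorph (EuclideanSpace ℝ (Fin n)) (EuclideanSpace ℝ (Fin n)),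
      IsChangeOfCharts (V.U i) (V.U i) (V.h i) (V.h i) (V.q i) (V.q i) φ ∧
        φ.source = V.U i ∧ ∀ x : V.U i, φ x = g x := by
  obtain ⟨φ, hs, ht, hφ, hφg⟩ := V.isometry_Γ i g hg
  refine ⟨φ, ⟨hs.subset, ht.subset, hs ▸ V.isConnected_U i, hφ, fun x hx => ?_⟩, hs, hφg⟩
  rw [hs] at hx
  rw [hφg ⟨x, hx⟩]
  exact ((V.q_eq_iff i ⟨x, hx⟩ (g ⟨x, hx⟩)).2 ⟨g, hg, rfl⟩).symm

theorem proj_act (v : V.Resolution) (M : Matrix.orthogonalGroup (Fin n) ℝ) :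
    V.proj (v.act M) = V.proj v := by
  induction v using Quot.ind
  rfl

theorem proj_surjective (V : RiemannianOrbifold n X ι) : Function.Surjective V.proj := fun v => by
  obtain ⟨i, x, hx, rfl⟩ := V.cover v
  obtain ⟨u, rfl⟩ := V.exists_frame hx
  exact ⟨Resolution.mk u, rfl⟩

/-- The leaves are the fibres of the projection. -/
theorem mem_leaf_iff {v w : V.Resolution} : w ∈ V.leaf v ↔ V.proj w = V.proj v := by
  constructor
  · rintro ⟨M, rfl⟩
    exact proj_act v M
  · induction v using Quot.ind with | _ v
    induction w using Quot.ind with | _ w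
    obtain ⟨i, u⟩ := v
    obtain ⟨j, w⟩ := w
    intro hq
    obtain ⟨φ, hu, hw, hφ⟩ := V.exists_change i j u.pt u.pt_mem w.pt w.pt_mem hq.symm
    obtain ⟨u₁, hu₁, e₁⟩ := u.exists_mk_eq hφ hu
    -- `φ` need not send `u.pt` to `w.pt`: the two points of chart `j` only have the same image
    -- under `q j`, and an element of `Γ j` corrects the difference.
    have hq₁ : V.q j u₁.pt = V.q j w.pt := by
      rw [hu₁, hφ.comp_eq _ hu]
      exact hq.symm
    obtain ⟨g, hg, hgu⟩ := (V.q_eq_iff j ⟨_, u₁.pt_mem⟩ ⟨_, w.pt_mem⟩).1 hq₁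
    obtain ⟨ψ, hψ, hs, hψg⟩ := V.exists_change_of_mem_Γ hg
    obtain ⟨u₂, hu₂, e₂⟩ := u₁.exists_mk_eq hψ (hs ▸ u₁.pt_mem)
    have hpt : u₂.pt = w.pt := by
      rw [hu₂, hψg ⟨_, u₁.pt_mem⟩, hgu]
    obtain ⟨M, rfl⟩ := Frame.exists_act_eq hpt
    exact ⟨M, congrArg (fun v : V.Resolution => v.act M) (e₁.trans e₂)⟩

/-- The pull-back of a smooth function is foliated. -/
theorem IsSmooth.isFoliated_comp_proj {f : X → ℝ} (hf : V.IsSmooth f) :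
    V.IsFoliated fun v => f (V.proj v) :=
  ⟨fun i s x _ => ⟨s.dom ×ˢ Set.univ, fun z => f (V.q i z.1), s.isOpen_dom.prod isOpen_univ,
    ⟨x.2, trivial⟩, (hf.contDiffOn i).comp contDiffOn_fst fun _ hz => s.dom_subset hz.1,
    fun _ _ _ => rfl⟩, fun _ _ hw => congrArg f (mem_leaf_iff.1 hw)⟩

/-- A function with smooth representatives in all the charts is smooth. -/
theorem isSmooth_of_contDiffOn {f : X → ℝ}
    (hf : ∀ i, ContDiffOn ℝ ∞ (fun x => f (V.q i x)) (V.U i)) : V.IsSmooth f := by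
  refine ⟨continuous_def.2 fun O hO => ?_, fun v =>
    let ⟨i, hi⟩ := V.cover v
    ⟨i, hi, hf i⟩⟩
  -- Continuity comes from openness of the `q i`: the preimage is a union of images of open sets.
  have : f ⁻¹' O = ⋃ i, V.q i '' (V.U i ∩ (fun x => f (V.q i x)) ⁻¹' O) := by
    ext v
    simp only [Set.mem_iUnion]
    constructor
    · intro hv
      obtain ⟨i, x, hx, rfl⟩ := V.cover v
      exact ⟨i, x, ⟨hx, hv⟩, rfl⟩
    · rintro ⟨i, x, ⟨-, hx⟩, rfl⟩
      exact hx
  rw [this]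
  exact isOpen_iUnion fun i => V.isOpen_image_q i _ Set.inter_subset_left
    ((hf i).continuousOn.isOpen_inter_preimage (V.isOpen_U i) hO)

/-- If the pull-back of a function to the resolution is smooth, the function is smooth. -/
theorem IsSmoothOnResolution.isSmooth {f : X → ℝ}
    (hf : V.IsSmoothOnResolution fun v => f (V.proj v)) : V.IsSmooth f := by
  refine isSmooth_of_contDiffOn fun i x hx => ContDiffAt.contDiffWithinAt ?_
  obtain ⟨s, hs⟩ := V.exists_trivialization hx
  -- The matrix `1` selects the section `y ↦ [s(y)]`, along which `f ∘ p` is `f ∘ q i`; `σ` is this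
  -- section in coordinates.
  obtain ⟨N, F, hN, hxN, hF, hFf⟩ := hf i s ⟨x, hs⟩ 1
  let σ : EuclideanSpace ℝ (Fin n) → EuclideanSpace ℝ (Fin n) × (Fin n → Fin n → ℝ) :=
    fun y => (y, fun a b => (1 : Matrix.orthogonalGroup (Fin n) ℝ).1 a b)
  have hσ : ContDiff ℝ ∞ σ := contDiff_id.prodMk contDiff_const
  refine ((hF.contDiffAt (hN.mem_nhds hxN)).comp (f := σ) x hσ.contDiffAt).congr_of_eventuallyEq ?_
  filter_upwards [s.isOpen_dom.mem_nhds hs, hσ.continuous.continuousAt (hN.mem_nhds hxN)]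
    with y hy hyN
  exact (hFf ⟨y, hy⟩ 1 hyN).symm

/-- Foliated functions descend to the orbifold. -/
theorem IsFoliated.exists_eq_comp_proj {g : V.Resolution → ℝ} (hg : V.IsFoliated g) :
    ∃ f, V.IsSmooth f ∧ (fun v => f (V.proj v)) = g := by
  -- The chosen point of each fibre is arbitrary: it lies in the leaf of `v`, where `g` is constant.
  have hf : (fun v => g (Function.surjInv V.proj_surjective (V.proj v))) = g := funext fun v =>
    hg.2 v _ (mem_leaf_iff.2 (Function.surjInv_eq V.proj_surjective _))
  refine ⟨fun x => g (Function.surjInv V.proj_surjective x), ?_, hf⟩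
  apply IsSmoothOnResolution.isSmooth
  rw [hf]
  exact hg.1

/-- The pull-back `p^*` of smooth functions to foliated functions, as a linear map. -/
def pullback (V : RiemannianOrbifold n X ι) : V.smoothFunctions →ₗ[ℝ] V.foliatedFunctions where
  toFun f := ⟨fun v => f.1 (V.proj v), IsSmooth.isFoliated_comp_proj f.2⟩
  map_add' _ _ := rfl
  map_smul' _ _ := rfl

theorem pullback_bijective (V : RiemannianOrbifold n X ι) : Function.Bijective V.pullback := by
  refine ⟨fun f g hfg => Subtype.ext (V.proj_surjective.injective_comp_right ?_), fun g => ?_⟩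
  · exact congrArg Subtype.val hfg
  · obtain ⟨f, hf, hfg⟩ := IsFoliated.exists_eq_comp_proj g.2
    exact ⟨⟨f, hf⟩, Subtype.ext hfg⟩

end RiemannianOrbifold

theorem mainTheorem2 {n : ℕ} {X ι : Type*} [TopologicalSpace X] [T2Space X]
    [SecondCountableTopology X] (V : RiemannianOrbifold n X ι) :
    ∃ e : V.smoothFunctions ≃ₗ[ℝ] V.foliatedFunctions,
      ∀ (f : V.smoothFunctions) (v : V.Resolution), (e f).1 v = f.1 (V.proj v) :=
  ⟨LinearEquiv.ofBijective V.pullback V.pullback_bijective, fun _ _ => rfl⟩
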